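/- **Definitions.** An *algebra* is a commutative, associative, unital $\mathbb{R}$-algebra; homomorphisms are unital. For an algebra $A$ let $|A|$ be the set of homomorphisms $A\to\mathbb{R}$ (the *points* of $A$), with the *weak topology*, the coarsest one for which every map $|A|\to\mathbb{R}$, $p\mapsto p(f)$ ($f\in A$), is continuous. $A$ is *geometric* if $\bigcap_{p\in|A|}\ker p=\{0\}$. For $S\subseteq|A|$ let $A_{|S}$ be the algebra of functions $f:S\to\mathbb{R}$ such that every $x\in S$ has an open neighbourhood $O\subseteq|A|$ and an element $\bar f\in A$ with $f(y)=y(\bar f)$ for all $y\in O\cap S$; let $\rho_S:A\to A_{|S}$, $\rho_S(f)(y)=y(f)$. $A$ is *complete* if $\rho_{|A|}:A\to A_{||A|}$ is surjective. $A$ is *smooth* if it is complete and geometric and, for some fixed $n\ge 0$, $|A|$ has a finite or countable (possibly empty) open covering by sets $U$ with $A_{|U}\cong C^\infty(\mathbb{R}^n)$. Let $\mathbf{SmoothMan}$ be the category of smooth manifolds of finite (constant) dimension that are Hausdorff, paracompact and have a countable base (they may be disconnected or empty), with smooth maps as arrows. Let $\mathbf{SmoothAlg}$ be the category of smooth algebras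 with algebra homomorphisms as arrows. **Theorem.** The categories $\mathbf{SmoothMan}$ and $\mathbf{SmoothAlg}$ are dual. More precisely: 1. For every $M$ in $\mathbf{SmoothMan}$, $C^\infty(M)$ is a smooth algebra, and $F(M)=C^\infty(M)$, $F(\phi)(f)=f\circ\phi$ defines a contravariant functor $F:\mathbf{SmoothMan}\to\mathbf{SmoothAlg}$. 2. For every smooth algebra $A$, the space $|A|$ with the weak topology carries a structure of smooth manifold (an object of $\mathbf{SmoothMan}$) of some dimension $n$, such that $|A|$ has a finite or countable open covering by sets $U$ with $A_{|U}\cong C^\infty(\mathbb{R}^n)$, and such that, for every open $U\subseteq|A|$ and every isomorphism $i:A_{|U}\to C^\infty(\mathbb{R}^n)$, there is a chart $\psi:U\to\mathbb{R}^n$ of this manifold, onto $\mathbb{R}^n$, with $\psi^{-1}(x)(f)=i(\rho_U(f))(x)$ for all $x\in\mathbb{R}^n$, $f\in A$. For any choice of such structures, $G(A)=|A|$, $G(\psi)=|\psi|:x\mapsto x\circ\psi$ defines a contravariant functor $G:\mathbf{SmoothAlg}\to\mathbf{SmoothMan}$. 3. The evaluation maps $\eta_A:A\to C^\infty(|A|)$,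 $\eta_A(f)(p)=p(f)$, and $\theta_M:M\to|C^\infty(M)|$, $\theta_M(p)(f)=f(p)$, are the components of natural isomorphisms $\eta:1_{\mathbf{SmoothAlg}}\Rightarrow F\circ G$ and $\theta:1_{\mathbf{SmoothMan}}\Rightarrow G\circ F$. -/

import Mathlib

open CategoryTheory Opposite
open scoped Manifold ContDiff

universe u

noncomputable section

namespace SmoothDuality

/-- Euclidean space `ℝⁿ`. -/
abbrev E (n : ℕ) : Type := EuclideanSpace ℝ (Fin n)

/-- The algebra `C^∞(ℝⁿ)`. -/
abbrev CInfE (n : ℕ) : Type := C^∞⟮𝓡 n, E n; ℝ⟯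

/-! ### Algebras and their points -/

section Algebras

/-- The dual space of points `|A|`: the unital algebra homomorphisms `A → ℝ`. -/
def Points (A : Type u) [CommRing A] [Algebra ℝ A] : Type u := A →ₐ[ℝ] ℝ

variable (A : Type u) [CommRing A] [Algebra ℝ A]

instance : FunLike (Points A) A ℝ := inferInstanceAs (FunLike (A →ₐ[ℝ] ℝ) A ℝ)

instance : AlgHomClass (Points A) ℝ A ℝ := inferInstanceAs (AlgHomClass (A →ₐ[ℝ] ℝ) ℝ A ℝ)

/-- The weak topology on `|A|`: the coarsest one for which all maps `p ↦ p f` are continuous. -/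
instance : TopologicalSpace (Points A) :=
  ⨅ f : A, TopologicalSpace.induced (fun p : Points A => p f) inferInstance

/-- An algebra is geometric if the kernels of its points intersect in `{0}`. -/
def IsGeometric : Prop := ⨅ p : Points A, RingHom.ker p = (⊥ : Ideal A)

variable {A}

/-- The restriction `A_{|S}`: functions on `S` that agree, near each point of `S`, with an
element of `A`. -/
def restriction (S : Set (Points A)) : Subalgebra ℝ (S → ℝ) where
  carrier := {f | ∀ x : S, ∃ O : Set (Points A), IsOpen O ∧ x.1 ∈ O ∧
    ∃ g : A, ∀ y : S, y.1 ∈ O → f y = y.1 g}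
  mul_mem' := by
    intro a b ha hb x
    obtain ⟨O, hO, hx, g, hg⟩ := ha x
    obtain ⟨O', hO', hx', g', hg'⟩ := hb x
    exact ⟨O ∩ O', hO.inter hO', ⟨hx, hx'⟩, g * g', fun y hy => by
      simp [hg y hy.1, hg' y hy.2]⟩
  add_mem' := by
    intro a b ha hb x
    obtain ⟨O, hO, hx, g, hg⟩ := ha x
    obtain ⟨O', hO', hx', g', hg'⟩ := hb x
    exact ⟨O ∩ O', hO.inter hO', ⟨hx, hx'⟩, g + g', fun y hy => by
      simp [hg y hy.1, hg' y hy.2]⟩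
  algebraMap_mem' := by
    intro r x
    exact ⟨Set.univ, isOpen_univ, trivial, algebraMap ℝ A r, fun y _ => by
      simp [AlgHomClass.commutes]⟩

/-- The restriction homomorphism `ρ_S : A → A_{|S}`. -/
def restrictionHom (S : Set (Points A)) : A →ₐ[ℝ] restriction S where
  toFun f := ⟨fun x => x.1 f, fun _ => ⟨Set.univ, isOpen_univ, trivial, f, fun _ _ => rfl⟩⟩
  map_one' := by ext x; exact map_one x.1
  map_mul' f g := by ext x; exact map_mul x.1 f g
  map_zero' := by ext x; exact map_zero x.1
  map_add' f g := by ext x; exact map_add x.1 f g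
  commutes' r := by ext x; exact AlgHomClass.commutes x.1 r

variable (A)

/-- An algebra is complete if it contains every function on `|A|` that agrees locally with
elements of `A`. -/
def IsCompleteAlgebra : Prop :=
  Function.Surjective (restrictionHom (Set.univ : Set (Points A)))

/-- `|A|` has a finite or countable open cover by sets `U` with `A_{|U} ≅ C^∞(ℝⁿ)`. -/
def HasEuclideanCover (n : ℕ) : Prop :=
  ∃ 𝒰 : Set (Set (Points A)), 𝒰.Countable ∧ ⋃₀ 𝒰 = Set.univ ∧
    ∀ U ∈ 𝒰, IsOpen U ∧ Nonempty (restriction U ≃ₐ[ℝ] CInfE n)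

/-- Smooth algebras. -/
structure IsSmoothAlgebra : Prop where
  geometric : IsGeometric A
  complete : IsCompleteAlgebra A
  cover : ∃ n : ℕ, HasEuclideanCover A n

variable {A}

/-- `e` is the chart `|i ∘ ρ_U|⁻¹ : U → ℝⁿ` induced by an isomorphism `i : A_{|U} ≅ C^∞(ℝⁿ)`,
where `ℝⁿ` is identified with `|C^∞(ℝⁿ)|` by evaluation. -/
structure IsInducedChart {n : ℕ} {U : Set (Points A)} (i : restriction U ≃ₐ[ℝ] CInfE n)
    (e : OpenPartialHomeomorph (Points A) (E n)) : Prop where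
  source_eq : e.source = U
  target_eq : e.target = Set.univ
  symm_apply : ∀ (x : E n) (f : A), e.symm x f = i (restrictionHom U f) x

variable (A)

/-- A structure of smooth manifold on `|A|` with the weak topology that is given by the induced
charts: `|A|` is covered by open sets `U` with `A_{|U} ≅ C^∞(ℝⁿ)`, and every such isomorphism
induces a chart that belongs to the maximal atlas. The atlas stored in `charted` need not be
maximal, but its maximal atlas, hence the smooth structure, is determined by these conditions. -/
structure InducedManifold where
  dim : ℕ
  charted : ChartedSpace (E dim) (Points A)
  isManifold : IsManifold (𝓡 dim) ∞ (Points A)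
  t2 : T2Space (Points A)
  paracompact : ParacompactSpace (Points A)
  secondCountable : SecondCountableTopology (Points A)
  cover : HasEuclideanCover A dim
  charts : ∀ U : Set (Points A), IsOpen U → ∀ i : restriction U ≃ₐ[ℝ] CInfE dim,
    ∃ e ∈ IsManifold.maximalAtlas (𝓡 dim) ∞ (Points A), IsInducedChart i e

variable {A}

/-- The map `|ψ| : |B| → |A|`, `x ↦ x ∘ ψ`. -/
def pointsMap {B : Type u} [CommRing B] [Algebra ℝ B] (ψ : A →ₐ[ℝ] B) : Points B → Points A :=
  fun x => AlgHom.comp (show B →ₐ[ℝ] ℝ from x) ψ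

end Algebras

/-! ### The categories -/

/-- Objects of `SmoothMan`: smooth manifolds (without boundary, of some fixed finite dimension),
Hausdorff and paracompact, with a countable base. -/
structure SmoothMan where
  carrier : Type u
  [top : TopologicalSpace carrier]
  dim : ℕ
  [charted : ChartedSpace (E dim) carrier]
  [isManifold : IsManifold (𝓡 dim) ∞ carrier]
  [t2 : T2Space carrier]
  [paracompact : ParacompactSpace carrier]
  [secondCountable : SecondCountableTopology carrier]

instance : CoeSort SmoothMan.{u} (Type u) := ⟨SmoothMan.carrier⟩

attribute [instance] SmoothMan.top SmoothMan.charted SmoothMan.isManifold SmoothMan.t2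
  SmoothMan.paracompact SmoothMan.secondCountable

/-- Arrows of `SmoothMan` are smooth maps. -/
instance : Category SmoothMan.{u} where
  Hom M N := C^∞⟮𝓡 M.dim, M; 𝓡 N.dim, N⟯
  id _ := ContMDiffMap.id
  comp φ χ := ContMDiffMap.comp χ φ

/-- Objects of `SmoothAlg`: smooth algebras. -/
structure SmoothAlg where
  carrier : Type u
  [ring : CommRing carrier]
  [algebra : Algebra ℝ carrier]
  smooth : IsSmoothAlgebra carrier

instance : CoeSort SmoothAlg.{u} (Type u) := ⟨SmoothAlg.carrier⟩

attribute [instance] SmoothAlg.ring SmoothAlg.algebra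

/-- Arrows of `SmoothAlg` are algebra homomorphisms. -/
instance : Category SmoothAlg.{u} where
  Hom A B := A →ₐ[ℝ] B
  id A := AlgHom.id ℝ A
  comp φ χ := AlgHom.comp χ φ

/-! ### The functors -/

/-- The algebra `C^∞(M)` of smooth functions `M → ℝ`. -/
abbrev CInf (M : SmoothMan.{u}) : Type u := C^∞⟮𝓡 M.dim, M; ℝ⟯

/-- The algebra homomorphism `φ̂ : C^∞(N) → C^∞(M)`, `f ↦ f ∘ φ`. -/
def CInf.pullback {M N : SmoothMan.{u}} (φ : C^∞⟮𝓡 M.dim, M; 𝓡 N.dim, N⟯) :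
    CInf N →ₐ[ℝ] CInf M where
  toFun f := f.comp φ
  map_one' := rfl
  map_mul' _ _ := rfl
  map_zero' := rfl
  map_add' _ _ := rfl
  commutes' _ := rfl

/-- The contravariant functor `M ↦ C^∞(M)`, `φ ↦ φ̂`, once the algebras `C^∞(M)` are known to be
smooth. -/
def functorF (hF : ∀ M : SmoothMan.{u}, IsSmoothAlgebra (CInf M)) :
    SmoothMan.{u}ᵒᵖ ⥤ SmoothAlg.{u} where
  obj M := { carrier := CInf M.unop, smooth := hF M.unop }
  map φ := CInf.pullback φ.unop
  map_id _ := rfl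
  map_comp _ _ := rfl

/-- `|A|` as an object of `SmoothMan`. -/
def InducedManifold.toSmoothMan {A : SmoothAlg.{u}} (s : InducedManifold A) :
    SmoothMan.{u} :=
  { carrier := Points A
    dim := s.dim
    charted := s.charted
    isManifold := s.isManifold
    t2 := s.t2
    paracompact := s.paracompact
    secondCountable := s.secondCountable }

/-- `|ψ| : |B| → |A|` as a map between the manifolds. -/
def InducedManifold.map {A B : SmoothAlg.{u}} (s : InducedManifold A) (t : InducedManifold B)
    (ψ : A →ₐ[ℝ] B) : t.toSmoothMan → s.toSmoothMan :=
  pointsMap ψ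

/-- All the maps `|ψ| : |B| → |A|` are smooth, for the given manifold structures on the spaces of
points. -/
def PointsMapsSmooth (s : ∀ A : SmoothAlg.{u}, InducedManifold A) : Prop :=
  ∀ (A B : SmoothAlg.{u}) (ψ : A →ₐ[ℝ] B),
    ContMDiff (𝓡 (s B).toSmoothMan.dim) (𝓡 (s A).toSmoothMan.dim) ∞ ((s A).map (s B) ψ)

/-- The contravariant functor `A ↦ |A|`, `ψ ↦ |ψ|`, once the manifold structures exist and the maps
`|ψ|` are known to be smooth. -/
def functorG (s : ∀ A : SmoothAlg.{u}, InducedManifold A) (hG : PointsMapsSmooth s) :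
    SmoothAlg.{u}ᵒᵖ ⥤ SmoothMan.{u} where
  obj A := (s A.unop).toSmoothMan
  map {A B} ψ := ⟨(s B.unop).map (s A.unop) ψ.unop, hG B.unop A.unop ψ.unop⟩
  map_id _ := rfl
  map_comp _ _ := rfl

/-- `η_A(f)` is the function `p ↦ p f` on `|A|`, for every `A` and `f`. -/
def IsEvalEta {hF : ∀ M : SmoothMan.{u}, IsSmoothAlgebra (CInf M)}
    {s : ∀ A : SmoothAlg.{u}, InducedManifold A} {hG : PointsMapsSmooth s}
    (η : 𝟭 SmoothAlg.{u} ⟶ (functorG s hG).rightOp ⋙ functorF hF) : Prop :=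
  ∀ (A : SmoothAlg.{u}) (f : A) (p : Points A),
    (show A →ₐ[ℝ] CInf (s A).toSmoothMan from η.app A) f p = p f

/-- `θ_M(x)` is the point `f ↦ f x` of `C^∞(M)`, for every `M` and `x`. -/
def IsEvalTheta {hF : ∀ M : SmoothMan.{u}, IsSmoothAlgebra (CInf M)}
    {s : ∀ A : SmoothAlg.{u}, InducedManifold A} {hG : PointsMapsSmooth s}
    (θ : 𝟭 SmoothMan.{u} ⟶ (functorF hF).rightOp ⋙ functorG s hG) : Prop :=
  ∀ (M : SmoothMan.{u}) (x : M) (f : CInf M),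
    (show M → Points (CInf M) from (θ.app M).1) x f = f x

end SmoothDuality

end

/-! Everything rests on one fact (`exists_eq_eval`): a homomorphism `P : C^∞(M) → ℝ` is evaluation
at a point. Otherwise each `p` has a smooth `f` with `P f ≠ f p`. A function `h` with compact
sublevel sets reduces this to finitely many `f`, and a sum of squares gives a nowhere vanishing,
hence invertible, element of `ker P`. With bump functions, which detect points, topology and
smoothness, this makes `θ_M` an isomorphism.

For an algebra `A`, the same fact on `ℝⁿ` turns an isomorphism `A_{|U} ≅ C^∞(ℝⁿ)` into a
homeomorphism `U ≅ ℝⁿ` (`exists_induced_homeomorph`). Transition maps are smooth because their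
coordinates are locally evaluations of elements of `A`. Smooth functions on `|A|` are exactly those
locally given by `A`, so completeness makes `η_A` surjective; geometricity makes it injective. -/

namespace SmoothDuality

open Set Filter Topology

/-! ### Smooth functions determine a manifold -/

section Manifold

variable {n : ℕ} {M : Type*} [TopologicalSpace M] [ChartedSpace (E n) M]
  [IsManifold (𝓡 n) ∞ M] [T2Space M]

/-- A function that is smooth near `p` agrees near `p` with a global smooth function. -/
theorem exists_contMDiffMap_eventuallyEq {f : M → ℝ} {s : Set M} {p : M} (hs : s ∈ 𝓝 p)
    (hf : ContMDiffOn (𝓡 n) 𝓘(ℝ, ℝ) ∞ f s) :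
    ∃ g : C^∞⟮𝓡 n, M; ℝ⟯, f =ᶠ[𝓝 p] g := by
  obtain ⟨b, -, hb⟩ := (SmoothBumpFunction.nhds_basis_tsupport (I := 𝓡 n) p).mem_iff.1
    (interior_mem_nhds.2 hs)
  have hsm : ContMDiff (𝓡 n) 𝓘(ℝ, ℝ) ∞ fun x => b x * f x := by
    refine contMDiff_of_tsupport fun x hx => ?_
    have hx' : x ∈ tsupport b := tsupport_mul_subset_left hx
    exact b.contMDiffAt.mul (hf.contMDiffAt (mem_interior_iff_mem_nhds.1 (hb hx')))
  refine ⟨⟨_, hsm⟩, ?_⟩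
  filter_upwards [b.eventuallyEq_one] with x hx
  simp [hx]

/-- A smooth function that is `1` at `p` and vanishes outside a given neighbourhood. -/
theorem exists_contMDiffMap_eq_one_support_subset {s : Set M} {p : M} (hs : s ∈ 𝓝 p) :
    ∃ g : C^∞⟮𝓡 n, M; ℝ⟯, g p = 1 ∧ ∀ x, g x ≠ 0 → x ∈ s := by
  obtain ⟨b, -, hb⟩ := (SmoothBumpFunction.nhds_basis_tsupport (I := 𝓡 n) p).mem_iff.1 hs
  exact ⟨⟨b, b.contMDiff⟩, b.eq_one, fun x hx => hb (subset_closure hx)⟩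

theorem eq_of_forall_contMDiffMap_eq {p q : M} (h : ∀ f : C^∞⟮𝓡 n, M; ℝ⟯, f p = f q) :
    p = q := by
  by_contra hpq
  obtain ⟨g, hg, hg'⟩ := exists_contMDiffMap_eq_one_support_subset (n := n) (p := p)
    (s := {q}ᶜ) (isOpen_ne.mem_nhds hpq)
  exact hg' q (by rw [← h g, hg]; exact one_ne_zero) rfl

/-- Bump functions show that the nonvanishing sets of smooth functions form a base of the topology
of `M`. -/
theorem continuous_of_forall_contMDiffMap {X : Type*} [TopologicalSpace X] {g : X → M}
    (h : ∀ f : C^∞⟮𝓡 n, M; ℝ⟯, Continuous fun x => f (g x)) : Continuous g := by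
  refine continuous_iff_continuousAt.2 fun x s hs => ?_
  obtain ⟨f, hf, hfs⟩ := exists_contMDiffMap_eq_one_support_subset (n := n) hs
  have : ∀ᶠ y in 𝓝 x, f (g y) ≠ 0 :=
    (h f).continuousAt.eventually_ne (by rw [hf]; exact one_ne_zero)
  exact mem_map.2 (this.mono fun y hy => hfs _ hy)

/-- A map to a manifold is smooth if its composites with all smooth functions are. -/
theorem contMDiff_of_forall_contMDiffMap {m : ℕ} {X : Type*} [TopologicalSpace X]
    [ChartedSpace (E m) X] {g : X → M}
    (h : ∀ f : C^∞⟮𝓡 n, M; ℝ⟯, ContMDiff (𝓡 m) 𝓘(ℝ, ℝ) ∞ fun x => f (g x)) :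
    ContMDiff (𝓡 m) (𝓡 n) ∞ g := by
  have hc : Continuous g := continuous_of_forall_contMDiffMap fun f => (h f).continuous
  intro x
  refine contMDiffAt_iff_target.2 ⟨hc.continuousAt, ?_⟩
  -- A chart coordinate is only local, but near `g x` it agrees with a global smooth function, to
  -- which `h` applies.
  have hcoord : ∀ k : Fin n, ContMDiffAt (𝓡 m) 𝓘(ℝ, ℝ) ∞
      (fun y => extChartAt (𝓡 n) (g x) (g y) k) x := by
    intro k
    have hk : ContMDiffOn (𝓡 n) 𝓘(ℝ, ℝ) ∞ (fun q : M => extChartAt (𝓡 n) (g x) q k)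
        (chartAt (E n) (g x)).source :=
      (EuclideanSpace.proj (𝕜 := ℝ) k).contMDiff.comp_contMDiffOn contMDiffOn_extChartAt
    obtain ⟨f, hf⟩ := exists_contMDiffMap_eventuallyEq
      ((chartAt (E n) (g x)).open_source.mem_nhds (mem_chart_source _ _)) hk
    exact (h f x).congr_of_eventuallyEq (hc.continuousAt.eventually hf)
  have hpi := contMDiffAt_pi_space.2 hcoord
  exact (EuclideanSpace.equiv (Fin n) ℝ).symm.contDiff.contMDiff.contMDiffAt.comp x hpi

/-- Every point of `C^∞(M)` is the evaluation at a point of `M`. -/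
theorem exists_eq_eval [SecondCountableTopology M] (P : C^∞⟮𝓡 n, M; ℝ⟯ →ₐ[ℝ] ℝ) :
    ∃ p : M, ∀ f, P f = f p := by
  have : LocallyCompactSpace M := ChartedSpace.locallyCompactSpace (E n) M
  let K : CompactExhaustion M := default
  -- `h` dominates the exhaustion index, so its sublevel sets lie in members of `K`. Locally the
  -- constant `K.find x + 1` suffices, and convexity allows gluing.
  obtain ⟨h, hh⟩ : ∃ h : C^∞⟮𝓡 n, M; ℝ⟯, ∀ x, h x ∈ Ici (K.find x : ℝ) := by
    refine exists_contMDiffMap_forall_mem_convex_of_local_const (𝓡 n)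
      (fun x => convex_Ici _) fun x => ⟨K.find x + 1, ?_⟩
    have : K (K.find x + 1) ∈ 𝓝 x := mem_interior_iff_mem_nhds.1
      (K.subset_interior_succ _ (K.mem_find x))
    filter_upwards [this] with y hy
    exact mem_Ici.2 (by exact_mod_cast K.mem_iff_find_le.1 hy)
  by_contra! hP
  choose f hf using hP
  have hcomp : IsCompact (h ⁻¹' {P h}) := by
    refine (K.isCompact ⌈P h⌉₊).of_isClosed_subset
      (isClosed_singleton.preimage h.contMDiff.continuous) fun x hx => ?_
    refine K.mem_iff_find_le.2 ?_
    have h1 : (K.find x : ℝ) ≤ h x := hh x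
    rw [show h x = P h from hx] at h1
    exact_mod_cast h1.trans (Nat.le_ceil _)
  obtain ⟨t, -, ht⟩ := hcomp.elim_nhds_subcover (fun p => {x | P (f p) ≠ f p x}) fun p _ =>
    (isOpen_ne_fun continuous_const (f p).contMDiff.continuous).mem_nhds (hf p)
  -- `P` kills every square. A zero of `g` would lie in the compact fibre `h = P h`, where some `f
  -- p` with `p ∈ t` differs from `P (f p)`.
  let g : C^∞⟮𝓡 n, M; ℝ⟯ := (h - algebraMap ℝ _ (P h)) ^ 2 +
    ∑ p ∈ t, (f p - algebraMap ℝ _ (P (f p))) ^ 2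
  have hPg : P g = 0 := by
    simp [g, AlgHomClass.commutes]
  have hg : ∀ x, g x = (h x - P h) ^ 2 + ∑ p ∈ t, (f p x - P (f p)) ^ 2 := by
    intro x
    let ev : C^∞⟮𝓡 n, M; ℝ⟯ →ₐ[ℝ] ℝ :=
      { toFun := fun f => f x
        map_one' := rfl
        map_mul' := fun _ _ => rfl
        map_zero' := rfl
        map_add' := fun _ _ => rfl
        commutes' := fun _ => rfl }
    change ev g = (ev h - P h) ^ 2 + ∑ p ∈ t, (ev (f p) - P (f p)) ^ 2
    simp [g]
  have hne : ∀ x, g x ≠ 0 := by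
    intro x hx
    rw [hg, add_eq_zero_iff_of_nonneg (sq_nonneg _) (Finset.sum_nonneg fun _ _ => sq_nonneg _),
      Finset.sum_eq_zero_iff_of_nonneg fun _ _ => sq_nonneg _] at hx
    obtain ⟨p, hp, hpx⟩ := mem_iUnion₂.1 (ht (show h x = P h by
      simpa [sub_eq_zero] using hx.1))
    exact hpx (sub_eq_zero.1 (pow_eq_zero_iff two_ne_zero |>.1 (hx.2 p hp))).symm
  let g' : C^∞⟮𝓡 n, M; ℝ⟯ := ⟨fun x => (g x)⁻¹, g.contMDiff.inv₀ hne⟩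
  have : g * g' = 1 := by
    ext x
    exact mul_inv_cancel₀ (hne x)
  have h1 := congrArg P this
  rw [map_mul, hPg, zero_mul, map_one] at h1
  exact zero_ne_one h1

end Manifold

end SmoothDuality
namespace SmoothDuality

open Set Filter Topology

/-! ### The weak topology and the induced charts on `|A|` -/

section Points

variable {A : Type u} [CommRing A] [Algebra ℝ A]

theorem Points.ext_eval {p q : Points A} (h : ∀ f : A, p f = q f) : p = q :=
  DFunLike.ext p q h

theorem Points.continuous_eval (f : A) : Continuous fun p : Points A => p f :=
  continuous_iInf_dom (i := f) continuous_induced_dom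

theorem Points.continuous_of_eval {X : Type*} [TopologicalSpace X] {g : X → Points A}
    (h : ∀ f : A, Continuous fun x => g x f) : Continuous g :=
  continuous_iInf_rng.2 fun f => continuous_induced_rng.2 (h f)

instance : T2Space (Points A) := by
  refine t2Space_iff_disjoint_nhds.2 fun p q hpq => ?_
  obtain ⟨f, hf⟩ : ∃ f : A, p f ≠ q f := by
    by_contra! h
    exact hpq (Points.ext_eval h)
  exact ((Points.continuous_eval f).tendsto p).disjoint (disjoint_nhds_nhds.2 hf)
    ((Points.continuous_eval f).tendsto q)

theorem restriction.exists_eventuallyEq {S : Set (Points A)} (h : restriction S) (x : S) :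
    ∃ f : A, ∀ᶠ y in 𝓝 x, (h : S → ℝ) y = y.1 f := by
  obtain ⟨O, hO, hx, f, hf⟩ := h.2 x
  exact ⟨f, mem_of_superset (continuous_subtype_val.continuousAt.preimage_mem_nhds
    (hO.mem_nhds hx)) hf⟩

theorem mem_restriction_iff {S : Set (Points A)} {h : S → ℝ} :
    h ∈ restriction S ↔ ∀ x : S, ∃ f : A, ∀ᶠ y in 𝓝 x, h y = y.1 f := by
  refine ⟨fun hh x => restriction.exists_eventuallyEq ⟨h, hh⟩ x, fun hh x => ?_⟩
  obtain ⟨f, hf⟩ := hh x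
  obtain ⟨O', hO', hs⟩ := mem_nhds_subtype S x _ |>.1 hf
  obtain ⟨O, hOO', hO, hx⟩ := mem_nhds_iff.1 hO'
  exact ⟨O, hO, hx, f, fun y hy => hs (show y.1 ∈ O' from hOO' hy)⟩

theorem restriction.continuous_coe {S : Set (Points A)} (h : restriction S) :
    Continuous (h : S → ℝ) := by
  refine continuous_iff_continuousAt.2 fun x => ?_
  obtain ⟨f, hf⟩ := restriction.exists_eventuallyEq h x
  exact ((Points.continuous_eval f).comp continuous_subtype_val).continuousAt.congr
    (hf.mono fun y hy => hy.symm)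

/-- Evaluation of elements of `A_{|S}` at a point of `S`. -/
def restriction.eval {S : Set (Points A)} (y : S) : restriction S →ₐ[ℝ] ℝ :=
  (Pi.evalAlgHom ℝ (fun _ : S => ℝ) y).comp (restriction S).val

/-- The `k`-th coordinate function on `ℝⁿ`. -/
def coordinate {n : ℕ} (k : Fin n) : CInfE n :=
  ⟨fun x => x k, (EuclideanSpace.proj (𝕜 := ℝ) k).contMDiff⟩

theorem contDiff_coe {n : ℕ} (f : CInfE n) : ContDiff ℝ ∞ f :=
  contMDiff_iff_contDiff.1 f.contMDiff

/-- An isomorphism `A_{|S} ≅ C^∞(ℝⁿ)` is induced by a homeomorphism `S ≅ ℝⁿ`. -/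
theorem exists_induced_homeomorph {n : ℕ} {S : Set (Points A)}
    (i : restriction S ≃ₐ[ℝ] CInfE n) :
    ∃ φ : S ≃ₜ E n, ∀ (h : restriction S) (y : S), (h : S → ℝ) y = i h (φ y) := by
  -- Evaluation at `y`, transported to `C^∞(ℝⁿ)` by `i`, is evaluation at `φ y`.
  choose φ hφ using fun y : S => exists_eq_eval (n := n) (M := E n)
    ((restriction.eval y).comp i.symm.toAlgHom)
  have key : ∀ (h : restriction S) (y : S), (h : S → ℝ) y = i h (φ y) := by
    intro h y
    rw [← hφ y (i h)]
    change _ = ((i.symm (i h) : restriction S) : S → ℝ) y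
    rw [i.symm_apply_apply]
  have key' : ∀ (g : CInfE n) (y : S), ((i.symm g : restriction S) : S → ℝ) y = g (φ y) := by
    intro g y
    rw [key, i.apply_symm_apply]
  have hcont : Continuous φ := continuous_of_forall_contMDiffMap (n := n) fun f =>
    (restriction.continuous_coe (i.symm f)).congr (key' f)
  have hinj : Function.Injective φ := by
    intro y z hyz
    refine Subtype.ext (Points.ext_eval fun f => ?_)
    have hy := key (restrictionHom S f) y
    rw [hyz, ← key] at hy
    exact hy
  -- Points of `A_{|S}` are not known to come from `S`. If `φ` misses `x`, the squared distance to
  -- `x` pulls back to an invertible element of `A_{|S}`, although it vanishes at `x`.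
  have hsurj : Function.Surjective φ := by
    intro x
    by_contra! hx
    have hd : ContDiff ℝ ∞ fun z : E n => ‖z - x‖ ^ 2 :=
      (contDiff_id.sub contDiff_const).norm_sq ℝ
    let d : CInfE n := ⟨fun z => ‖z - x‖ ^ 2, hd.contMDiff⟩
    have hdne : ∀ z, z ≠ x → ‖z - x‖ ^ 2 ≠ 0 := fun z hz =>
      pow_ne_zero _ (norm_ne_zero_iff.2 (sub_ne_zero.2 hz))
    have hk : (fun y : S => (‖φ y - x‖ ^ 2)⁻¹) ∈ restriction S := by
      refine mem_restriction_iff.2 fun y => ?_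
      obtain ⟨g, hg⟩ := exists_contMDiffMap_eventuallyEq (n := n) (p := φ y) (s := {x}ᶜ)
        (f := fun z => (‖z - x‖ ^ 2)⁻¹) (isOpen_ne.mem_nhds (hx y))
        (hd.contDiffOn.inv fun z hz => hdne z hz).contMDiffOn
      obtain ⟨f, hf⟩ := restriction.exists_eventuallyEq (i.symm g) y
      refine ⟨f, ?_⟩
      filter_upwards [hf, hcont.continuousAt.eventually hg] with z hz hz'
      rw [← hz, key', hz']
    have hmul : i.symm d * ⟨_, hk⟩ = 1 := by
      ext y
      change ((i.symm d : restriction S) : S → ℝ) y * (‖φ y - x‖ ^ 2)⁻¹ = 1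
      rw [key']
      exact mul_inv_cancel₀ (hdne _ (hx y))
    have h1 := congrArg (fun g : CInfE n => g x) (congrArg i hmul)
    simp only [map_mul, map_one, AlgEquiv.apply_symm_apply] at h1
    change ‖x - x‖ ^ 2 * _ = (1 : ℝ) at h1
    simp at h1
  let e : S ≃ E n := Equiv.ofBijective φ ⟨hinj, hsurj⟩
  have he : ∀ (x : E n) (f : A), (e.symm x).1 f = i (restrictionHom S f) x := by
    intro x f
    have := key (restrictionHom S f) (e.symm x)
    rw [show φ (e.symm x) = x from e.apply_symm_apply x] at this
    exact this
  refine ⟨⟨e, hcont, continuous_induced_rng.2 (Points.continuous_of_eval fun f => ?_)⟩, key⟩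
  exact (contDiff_coe (i (restrictionHom S f))).continuous.congr fun x => (he x f).symm

theorem exists_isInducedChart {n : ℕ} {U : Set (Points A)} (hU : IsOpen U)
    (i : restriction U ≃ₐ[ℝ] CInfE n) :
    ∃ e : OpenPartialHomeomorph (Points A) (E n), IsInducedChart i e := by
  obtain ⟨φ, hφ⟩ := exists_induced_homeomorph i
  have ho : IsOpenEmbedding fun x : E n => (φ.symm x).1 :=
    hU.isOpenEmbedding_subtypeVal.comp φ.symm.isOpenEmbedding
  refine ⟨(ho.toOpenPartialHomeomorph _).symm, ?_, rfl, fun x f => ?_⟩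
  · change (fun x : E n => (φ.symm x).1) '' univ = U
    rw [image_univ, show (fun x : E n => (φ.symm x).1) = Subtype.val ∘ φ.symm from rfl,
      φ.symm.surjective.range_comp, Subtype.range_val]
  · have := hφ (restrictionHom U f) (φ.symm x)
    rw [φ.apply_symm_apply] at this
    exact this

/-- The definition prescribes `e.symm` only on `A`. Since `A` separates points, `e` is the induced
homeomorphism, and the formula extends to `A_{|U}`. -/
theorem IsInducedChart.apply_eq {n : ℕ} {U : Set (Points A)} {i : restriction U ≃ₐ[ℝ] CInfE n}
    {e : OpenPartialHomeomorph (Points A) (E n)} (he : IsInducedChart i e)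
    (h : restriction U) (y : U) : (h : U → ℝ) y = i h (e y) := by
  obtain ⟨φ, hφ⟩ := exists_induced_homeomorph i
  have h1 : e.symm (φ y) = y := Points.ext_eval fun f => by
    rw [he.symm_apply, ← hφ]
    rfl
  have h2 : e y = φ y := by
    rw [← h1, e.right_inv (by rw [he.target_eq]; trivial)]
  rw [h2, hφ]

/-- Each coordinate of `e'` is locally evaluation of some `f : A`, which in the chart `e` is the
smooth function `i (restrictionHom U f)`. -/
theorem IsInducedChart.contDiffOn_symm_trans {n : ℕ} {U V : Set (Points A)}
    {i : restriction U ≃ₐ[ℝ] CInfE n} {j : restriction V ≃ₐ[ℝ] CInfE n}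
    {e e' : OpenPartialHomeomorph (Points A) (E n)} (he : IsInducedChart i e)
    (he' : IsInducedChart j e') :
    ContDiffOn ℝ ∞ (e.symm ≫ₕ e') (e.symm ≫ₕ e').source := by
  refine fun x hx => ContDiffAt.contDiffWithinAt (contDiffAt_euclidean.2 fun k => ?_)
  have hxV : e.symm x ∈ V := by
    rw [← he'.source_eq]
    exact hx.2
  have hV : IsOpen V := he'.source_eq ▸ e'.open_source
  obtain ⟨O, hO, hxO, f, hf⟩ := (j.symm (coordinate k)).2 ⟨_, hxV⟩
  refine ((contDiff_coe (i (restrictionHom U f))).contDiffAt).congr_of_eventuallyEq ?_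
  have hc : ContinuousAt e.symm x := e.symm.continuousAt hx.1
  filter_upwards [hc.preimage_mem_nhds (hO.mem_nhds hxO), hc.preimage_mem_nhds (hV.mem_nhds hxV)]
    with z hzO hzV
  rw [← he.symm_apply, ← hf ⟨_, hzV⟩ hzO, he'.apply_eq, j.apply_symm_apply]
  rfl

/-- The charts induced by all isomorphisms `A_{|U} ≅ C^∞(ℝⁿ)`. -/
def inducedCharts (A : Type u) [CommRing A] [Algebra ℝ A] (n : ℕ) :
    Set (OpenPartialHomeomorph (Points A) (E n)) :=
  {e | ∃ (U : Set (Points A)) (i : restriction U ≃ₐ[ℝ] CInfE n), IsInducedChart i e}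

theorem HasEuclideanCover.exists_mem_inducedCharts {n : ℕ} (hA : HasEuclideanCover A n)
    (p : Points A) : ∃ e ∈ inducedCharts A n, p ∈ e.source := by
  obtain ⟨𝒰, -, hcov, h𝒰⟩ := hA
  obtain ⟨U, hU, hp⟩ := mem_sUnion.1 (hcov ▸ mem_univ p)
  obtain ⟨hUo, ⟨i⟩⟩ := h𝒰 U hU
  obtain ⟨e, he⟩ := exists_isInducedChart hUo i
  exact ⟨e, ⟨U, i, he⟩, he.source_eq ▸ hp⟩

theorem HasEuclideanCover.secondCountableTopology {n : ℕ} (hA : HasEuclideanCover A n) :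
    SecondCountableTopology (Points A) := by
  obtain ⟨𝒰, hc, hcov, h𝒰⟩ := hA
  have := hc.toEncodable
  have hU : ∀ U : 𝒰, SecondCountableTopology U.1 := fun U => by
    obtain ⟨φ, -⟩ := exists_induced_homeomorph (h𝒰 U.1 U.2).2.some
    exact φ.secondCountableTopology
  exact TopologicalSpace.secondCountableTopology_of_countable_cover
    (fun U : 𝒰 => (h𝒰 U.1 U.2).1) (by rw [← sUnion_eq_iUnion, hcov])

/-- The manifold structure on `|A|` whose atlas consists of all induced charts. -/
noncomputable def HasEuclideanCover.inducedManifold {n : ℕ} (hA : HasEuclideanCover A n) :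
    InducedManifold A :=
  letI charted : ChartedSpace (E n) (Points A) :=
    { atlas := inducedCharts A n
      chartAt := fun p => (hA.exists_mem_inducedCharts p).choose
      mem_chart_source := fun p => (hA.exists_mem_inducedCharts p).choose_spec.2
      chart_mem_atlas := fun p => (hA.exists_mem_inducedCharts p).choose_spec.1 }
  haveI manifold : IsManifold (𝓡 n) ∞ (Points A) := by
    refine isManifold_of_contDiffOn _ _ _ ?_
    rintro e e' ⟨U, i, he⟩ ⟨V, j, he'⟩
    simpa using he.contDiffOn_symm_trans he'
  -- With local compactness and Hausdorffness, this yields paracompactness by instance search.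
  haveI : SecondCountableTopology (Points A) := hA.secondCountableTopology
  haveI : LocallyCompactSpace (Points A) := ChartedSpace.locallyCompactSpace (E n) _
  { dim := n
    charted := charted
    isManifold := manifold
    t2 := inferInstance
    paracompact := inferInstance
    secondCountable := inferInstance
    cover := hA
    charts := fun U hU i => by
      obtain ⟨e, he⟩ := exists_isInducedChart hU i
      exact ⟨e, IsManifold.subset_maximalAtlas ⟨U, i, he⟩, he⟩ }

end Points

end SmoothDuality
namespace SmoothDuality

open Set Filter Topology

/-! ### Smooth functions on `|A|` and the isomorphism `η` -/

section Eta

variable {A : Type u} [CommRing A] [Algebra ℝ A] {n : ℕ} [ChartedSpace (E n) (Points A)]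
  {U : Set (Points A)} {i : restriction U ≃ₐ[ℝ] CInfE n}
  {e : OpenPartialHomeomorph (Points A) (E n)}

theorem IsInducedChart.contMDiffAt_eval (he : IsInducedChart i e)
    (hmem : e ∈ IsManifold.maximalAtlas (𝓡 n) ∞ (Points A)) {p : Points A} (hp : p ∈ U) (f : A) :
    ContMDiffAt (𝓡 n) 𝓘(ℝ, ℝ) ∞ (fun q : Points A => q f) p := by
  have hUo : IsOpen U := he.source_eq ▸ e.open_source
  have h1 : ContMDiffAt (𝓡 n) (𝓡 n) ∞ e p :=
    contMDiffAt_of_mem_maximalAtlas hmem (he.source_eq.symm ▸ hp)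
  refine ((i (restrictionHom U f)).contMDiff.contMDiffAt.comp p h1).congr_of_eventuallyEq ?_
  filter_upwards [hUo.mem_nhds hp] with q hq
  exact he.apply_eq (restrictionHom U f) ⟨q, hq⟩

/-- Read in the chart, `g` lies in `C^∞(ℝⁿ)`; `i.symm` sends it to `A_{|U}`, whose elements are
locally in `A`. -/
theorem IsInducedChart.exists_eventuallyEq_eval (he : IsInducedChart i e)
    (hmem : e ∈ IsManifold.maximalAtlas (𝓡 n) ∞ (Points A)) {p : Points A} (hp : p ∈ U)
    (g : C^∞⟮𝓡 n, Points A; ℝ⟯) : ∃ f : A, ∀ᶠ q in 𝓝 p, g q = q f := by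
  have hUo : IsOpen U := he.source_eq ▸ e.open_source
  have hsymm : ContMDiff (𝓡 n) (𝓡 n) ∞ e.symm := by
    have := contMDiffOn_symm_of_mem_maximalAtlas hmem
    rwa [he.target_eq, contMDiffOn_univ] at this
  let k : CInfE n := ⟨fun x => g (e.symm x), g.contMDiff.comp hsymm⟩
  obtain ⟨f, hf⟩ := restriction.exists_eventuallyEq (i.symm k) ⟨p, hp⟩
  refine ⟨f, ?_⟩
  rw [← map_nhds_subtype_coe_eq_nhds hp (hUo.mem_nhds hp), eventually_map]
  filter_upwards [hf] with q hq
  rw [← hq, he.apply_eq, i.apply_symm_apply]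
  exact congrArg g (e.left_inv (he.source_eq.symm ▸ q.2)).symm

end Eta

theorem InducedManifold.exists_isInducedChart {A : Type u} [CommRing A] [Algebra ℝ A]
    (s : InducedManifold A) (p : Points A) :
    letI := s.charted
    ∃ (U : Set (Points A)) (i : restriction U ≃ₐ[ℝ] CInfE s.dim),
      ∃ e ∈ IsManifold.maximalAtlas (𝓡 s.dim) ∞ (Points A), IsInducedChart i e ∧ p ∈ U := by
  obtain ⟨𝒰, -, hcov, h𝒰⟩ := s.cover
  obtain ⟨U, hU, hp⟩ := mem_sUnion.1 (hcov ▸ mem_univ p)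
  obtain ⟨hUo, ⟨i⟩⟩ := h𝒰 U hU
  obtain ⟨e, he, hie⟩ := s.charts U hUo i
  exact ⟨U, i, e, he, hie, hp⟩

theorem InducedManifold.contMDiff_eval {A : SmoothAlg.{u}} (s : InducedManifold A) (f : A) :
    ContMDiff (𝓡 s.toSmoothMan.dim) 𝓘(ℝ, ℝ) ∞
      (fun p : s.toSmoothMan => (show Points A from p) f) := by
  intro p
  let := s.charted
  have := s.isManifold
  obtain ⟨U, i, e, he, hie, hp⟩ := s.exists_isInducedChart p
  exact hie.contMDiffAt_eval he hp f

/-- `g` is locally given by elements of `A`, so completeness supplies a global one. -/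
theorem InducedManifold.exists_eq_eval {A : SmoothAlg.{u}} (s : InducedManifold A)
    (g : CInf s.toSmoothMan) : ∃ f : A, ∀ p : Points A, g p = p f := by
  let := s.charted
  have := s.isManifold
  have hg : (fun x : (univ : Set (Points A)) => g x.1) ∈ restriction (univ : Set (Points A)) := by
    refine mem_restriction_iff.2 fun x => ?_
    obtain ⟨U, i, e, he, hie, hp⟩ := s.exists_isInducedChart x.1
    obtain ⟨f, hf⟩ := hie.exists_eventuallyEq_eval he hp g
    exact ⟨f, continuous_subtype_val.continuousAt.eventually hf⟩
  obtain ⟨f, hf⟩ := A.smooth.complete ⟨_, hg⟩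
  exact ⟨f, fun p => (congrFun (congrArg Subtype.val hf) ⟨p, trivial⟩).symm⟩

/-- The homomorphism `η_A : A → C^∞(|A|)`. -/
def InducedManifold.etaHom {A : SmoothAlg.{u}} (s : InducedManifold A) :
    A →ₐ[ℝ] CInf s.toSmoothMan where
  toFun f := ⟨fun p => (show Points A from p) f, s.contMDiff_eval f⟩
  map_one' := by ext p; exact map_one (show Points A from p)
  map_mul' f g := by ext p; exact map_mul (show Points A from p) f g
  map_zero' := by ext p; exact map_zero (show Points A from p)
  map_add' f g := by ext p; exact map_add (show Points A from p) f g
  commutes' r := by ext p; exact AlgHomClass.commutes (show Points A from p) r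

theorem InducedManifold.bijective_etaHom {A : SmoothAlg.{u}} (s : InducedManifold A) :
    Function.Bijective s.etaHom := by
  refine ⟨(injective_iff_map_eq_zero _).2 fun f hf => ?_, fun g => ?_⟩
  · have h0 : f ∈ ⨅ p : Points A, RingHom.ker p := by
      refine (Submodule.mem_iInf _).2 fun p => ?_
      exact congrArg (fun g : CInf s.toSmoothMan => g p) hf
    rw [A.smooth.geometric] at h0
    exact h0
  · obtain ⟨f, hf⟩ := s.exists_eq_eval g
    exact ⟨f, by ext p; exact (hf p).symm⟩

/-- A map to `|A|` is smooth if its composites with the evaluations at all `f ∈ A` are. -/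
theorem InducedManifold.contMDiff_of_eval {A : SmoothAlg.{u}} (s : InducedManifold A) {m : ℕ}
    {X : Type*} [TopologicalSpace X] [ChartedSpace (E m) X] {g : X → s.toSmoothMan}
    (h : ∀ f : A, ContMDiff (𝓡 m) 𝓘(ℝ, ℝ) ∞ fun x => (show Points A from g x) f) :
    ContMDiff (𝓡 m) (𝓡 s.toSmoothMan.dim) ∞ g := by
  refine contMDiff_of_forall_contMDiffMap fun k => ?_
  obtain ⟨f, hf⟩ := s.exists_eq_eval k
  exact (h f).congr fun x => hf (g x)

theorem pointsMapsSmooth (s : ∀ A : SmoothAlg.{u}, InducedManifold A) : PointsMapsSmooth s :=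
  fun A B ψ => (s A).contMDiff_of_eval fun f => (s B).contMDiff_eval (ψ f)

/-! ### Smoothness of the algebra `C^∞(M)` and the homeomorphism `θ` -/

section Theta

variable (n : ℕ) (M : Type u) [TopologicalSpace M] [ChartedSpace (E n) M]

/-- The map `θ_M : M → |C^∞(M)|`. -/
noncomputable def theta (x : M) : Points C^∞⟮𝓡 n, M; ℝ⟯ :=
  show C^∞⟮𝓡 n, M; ℝ⟯ →ₐ[ℝ] ℝ from
  { toFun := fun f => f x
    map_one' := rfl
    map_mul' := fun _ _ => rfl
    map_zero' := rfl
    map_add' := fun _ _ => rfl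
    commutes' := fun _ => rfl }

variable {n M}

theorem isGeometric_contMDiffMap : IsGeometric C^∞⟮𝓡 n, M; ℝ⟯ := by
  refine (Submodule.eq_bot_iff _).2 fun f hf => ?_
  ext x
  exact (Submodule.mem_iInf _).1 hf (theta n M x)

theorem continuous_theta : Continuous (theta n M) :=
  Points.continuous_of_eval fun f => f.contMDiff.continuous

/-- Every point of a manifold is in the domain of a chart onto `ℝⁿ`. -/
theorem exists_chart_target_eq_univ [IsManifold (𝓡 n) ∞ M] (p : M) :
    ∃ e : OpenPartialHomeomorph M (E n), p ∈ e.source ∧ e.target = univ ∧ ContMDiffOn (𝓡 n) (𝓡 n) ∞ e e.source ∧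
      ContMDiffOn (𝓡 n) (𝓡 n) ∞ e.symm e.target := by
  set c := chartAt (E n) p
  obtain ⟨r, hr, hrc⟩ := Metric.isOpen_iff.1 c.open_target (c p)
    (c.map_source (mem_chart_source _ p))
  -- A diffeomorphism of `ℝⁿ` onto a ball inside the chart's target; undoing it stretches the chart
  -- onto all of `ℝⁿ`.
  let b := OpenPartialHomeomorph.univBall (c p) r
  have hb : b.target = Metric.ball (c p) r := OpenPartialHomeomorph.univBall_target _ hr
  have hbs : b.source = univ := OpenPartialHomeomorph.univBall_source _ _
  refine ⟨c ≫ₕ b.symm, ?_, ?_, ?_, ?_⟩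
  · simp [hb, hr, c]
  · ext z
    have hbz : b z ∈ c.target := hrc (hb ▸ b.map_source (hbs ▸ mem_univ z))
    simp [hbs, hbz]
  · have h1 : ContMDiffOn (𝓡 n) (𝓡 n) ∞ b.symm (Metric.ball (c p) r) :=
      OpenPartialHomeomorph.contDiffOn_univBall_symm.contMDiffOn
    refine h1.comp ((contMDiffOn_chart (x := p)).mono fun q hq => hq.1) fun q hq => ?_
    rw [← hb]
    exact hq.2
  · have h1 : ContMDiff (𝓡 n) (𝓡 n) ∞ b :=
      OpenPartialHomeomorph.contDiff_univBall.contMDiff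
    refine (contMDiffOn_chart_symm (x := p)).comp h1.contMDiffOn fun z hz => ?_
    exact hrc (hb ▸ b.map_source (hbs ▸ mem_univ z))

variable [IsManifold (𝓡 n) ∞ M] [T2Space M] [SecondCountableTopology M]

theorem bijective_theta : Function.Bijective (theta n M) :=
  ⟨fun _ _ h => eq_of_forall_contMDiffMap_eq fun f => DFunLike.congr_fun h f, fun P => by
    obtain ⟨p, hp⟩ := exists_eq_eval (show C^∞⟮𝓡 n, M; ℝ⟯ →ₐ[ℝ] ℝ from P)
    exact ⟨p, Points.ext_eval fun f => (hp f).symm⟩⟩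

variable (n M) in
/-- The homeomorphism `θ_M : M ≅ |C^∞(M)|`. -/
noncomputable def thetaHomeomorph : M ≃ₜ Points C^∞⟮𝓡 n, M; ℝ⟯ where
  toEquiv := Equiv.ofBijective (theta n M) bijective_theta
  continuous_toFun := continuous_theta
  continuous_invFun := continuous_of_forall_contMDiffMap fun f =>
    (Points.continuous_eval f).congr fun P =>
      (DFunLike.congr_fun ((Equiv.ofBijective _ bijective_theta).apply_symm_apply P) f).symm

theorem eval_eq_apply_thetaHomeomorph_symm (P : Points C^∞⟮𝓡 n, M; ℝ⟯) (f : C^∞⟮𝓡 n, M; ℝ⟯) :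
    P f = f ((thetaHomeomorph n M).symm P) :=
  (DFunLike.congr_fun ((thetaHomeomorph n M).apply_symm_apply P) f).symm

/-- Elements of `C^∞(M)_{|S}`, for open `S`, are the smooth functions on `S`. -/
theorem mem_restriction_contMDiffMap_iff {S : Set (Points C^∞⟮𝓡 n, M; ℝ⟯)} (hS : IsOpen S)
    {h : S → ℝ} : h ∈ restriction S ↔ ∀ (x : M) (_ : theta n M x ∈ S),
      ∃ f : C^∞⟮𝓡 n, M; ℝ⟯, ∀ᶠ y in 𝓝 x, ∀ hy : theta n M y ∈ S, h ⟨_, hy⟩ = f y := by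
  -- As `S` is open and `θ` a homeomorphism, neighbourhoods of `θ x` in `S` correspond to those of
  -- `x` in `M`.
  have hnhds : ∀ (x : M) (hx : theta n M x ∈ S) (p : Points C^∞⟮𝓡 n, M; ℝ⟯ → Prop),
      (∀ᶠ P in 𝓝 (⟨_, hx⟩ : S), p P.1) ↔ ∀ᶠ y in 𝓝 x, p (theta n M y) := by
    intro x hx p
    rw [← eventually_map (m := (Subtype.val : S → _)) (P := p),
      map_nhds_subtype_coe_eq_nhds hx (hS.mem_nhds hx), ← eventually_map (m := theta n M) (P := p)]
    exact iff_of_eq (congrArg (fun l => ∀ᶠ P in l, p P) ((thetaHomeomorph n M).map_nhds_eq x).symm)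
  rw [mem_restriction_iff]
  have key : ∀ (x : M) (hx : theta n M x ∈ S) (f : C^∞⟮𝓡 n, M; ℝ⟯),
      (∀ᶠ P in 𝓝 (⟨_, hx⟩ : S), h P = P.1 f) ↔
        ∀ᶠ y in 𝓝 x, ∀ hy : theta n M y ∈ S, h ⟨_, hy⟩ = f y := by
    intro x hx f
    refine Iff.trans ?_ (hnhds x hx fun P => ∀ hP : P ∈ S, h ⟨P, hP⟩ = P f)
    exact eventually_congr (.of_forall fun P => ⟨fun H _ => H, fun H => H P.2⟩)
  refine ⟨fun H x hx => ?_, fun H P => ?_⟩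
  · obtain ⟨f, hf⟩ := H ⟨_, hx⟩
    exact ⟨f, (key x hx f).1 hf⟩
  · obtain ⟨P, hP⟩ := P
    obtain ⟨x, rfl⟩ := (thetaHomeomorph n M).surjective P
    obtain ⟨f, hf⟩ := H x hP
    exact ⟨f, (key x hP f).2 hf⟩

theorem isCompleteAlgebra_contMDiffMap : IsCompleteAlgebra C^∞⟮𝓡 n, M; ℝ⟯ := by
  intro h
  have hh := (mem_restriction_contMDiffMap_iff isOpen_univ).1 h.2
  refine ⟨⟨fun x => h.1 ⟨theta n M x, trivial⟩, fun x => ?_⟩, ?_⟩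
  · obtain ⟨f, hf⟩ := hh x trivial
    exact (f.contMDiff x).congr_of_eventuallyEq (hf.mono fun y hy => hy trivial)
  · ext ⟨P, hP⟩
    obtain ⟨x, rfl⟩ := (thetaHomeomorph n M).surjective P
    rfl

/-- A chart of `M` onto `ℝⁿ` gives an isomorphism `C^∞(M)_{|U} ≅ C^∞(ℝⁿ)`. -/
theorem nonempty_restriction_algEquiv {e : OpenPartialHomeomorph M (E n)}
    (he : ContMDiffOn (𝓡 n) (𝓡 n) ∞ e e.source)
    (he' : ContMDiffOn (𝓡 n) (𝓡 n) ∞ e.symm e.target) (ht : e.target = univ) :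
    Nonempty (restriction (thetaHomeomorph n M '' e.source) ≃ₐ[ℝ] CInfE n) := by
  set S := thetaHomeomorph n M '' e.source with hSdef
  have hS : IsOpen S := (thetaHomeomorph n M).isOpenMap _ e.open_source
  have hmem : ∀ x, theta n M x ∈ S ↔ x ∈ e.source := fun x =>
    (thetaHomeomorph n M).injective.mem_set_image
  have hz : ∀ z, theta n M (e.symm z) ∈ S := fun z =>
    (hmem _).2 (e.map_target (ht ▸ mem_univ z))
  have hsymm : ContMDiff (𝓡 n) (𝓡 n) ∞ e.symm := by
    rwa [ht, contMDiffOn_univ] at he'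
  let Φ : restriction S →ₐ[ℝ] CInfE n :=
    { toFun := fun h => ⟨fun z => h.1 ⟨_, hz z⟩, fun z => by
        obtain ⟨f, hf⟩ := (mem_restriction_contMDiffMap_iff hS).1 h.2 _ (hz z)
        refine ((f.contMDiff.comp hsymm) z).congr_of_eventuallyEq ?_
        exact (hsymm.continuous.continuousAt.eventually hf).mono fun w hw => hw (hz w)⟩
      map_one' := rfl
      map_mul' := fun _ _ => rfl
      map_zero' := rfl
      map_add' := fun _ _ => rfl
      commutes' := fun _ => rfl }
  refine ⟨AlgEquiv.ofBijective Φ ⟨(injective_iff_map_eq_zero _).2 fun h hh => ?_, fun g => ?_⟩⟩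
  · ext ⟨P, hP⟩
    obtain ⟨x, rfl⟩ := (thetaHomeomorph n M).surjective P
    have := congrArg (fun g : CInfE n => g (e x)) hh
    change h.1 ⟨theta n M (e.symm (e x)), _⟩ = 0 at this
    simp only [e.left_inv ((hmem x).1 hP)] at this
    exact this
  · have hg : (fun P : S => g (e ((thetaHomeomorph n M).symm P))) ∈ restriction S := by
      refine (mem_restriction_contMDiffMap_iff hS).2 fun x hx => ?_
      obtain ⟨f, hf⟩ := exists_contMDiffMap_eventuallyEq
        (e.open_source.mem_nhds ((hmem x).1 hx)) (g.contMDiff.comp_contMDiffOn he)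
      refine ⟨f, hf.mono fun y hy _ => ?_⟩
      rw [← hy]
      exact congrArg (fun q => g (e q)) ((thetaHomeomorph n M).symm_apply_apply y)
    refine ⟨⟨_, hg⟩, ?_⟩
    ext z
    change g (e ((thetaHomeomorph n M).symm (thetaHomeomorph n M (e.symm z)))) = g z
    rw [Homeomorph.symm_apply_apply, e.right_inv (ht ▸ mem_univ z)]

/-- The Lindelöf property extracts a countable family from the charts onto `ℝⁿ`. -/
theorem hasEuclideanCover_contMDiffMap : HasEuclideanCover C^∞⟮𝓡 n, M; ℝ⟯ n := by
  choose e hp ht he he' using exists_chart_target_eq_univ (n := n) (M := M)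
  obtain ⟨t, htc, hcov⟩ := TopologicalSpace.countable_cover_nhds fun p : M =>
    (e p).open_source.mem_nhds (hp p)
  refine ⟨(fun p => thetaHomeomorph n M '' (e p).source) '' t, htc.image _, ?_, ?_⟩
  · rw [sUnion_image, ← image_iUnion₂, hcov, image_univ, (thetaHomeomorph n M).range_coe]
  · rintro _ ⟨p, -, rfl⟩
    exact ⟨(thetaHomeomorph n M).isOpenMap _ (e p).open_source,
      nonempty_restriction_algEquiv (he p) (he' p) (ht p)⟩

theorem isSmoothAlgebra_contMDiffMap : IsSmoothAlgebra C^∞⟮𝓡 n, M; ℝ⟯ where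
  geometric := isGeometric_contMDiffMap
  complete := isCompleteAlgebra_contMDiffMap
  cover := ⟨n, hasEuclideanCover_contMDiffMap⟩

end Theta

/-- The isomorphism `η_A` in `SmoothAlg`. -/
noncomputable def etaIso (hF : ∀ M : SmoothMan.{u}, IsSmoothAlgebra (CInf M))
    (s : ∀ A : SmoothAlg.{u}, InducedManifold A) (hG : PointsMapsSmooth s) (A : SmoothAlg.{u}) :
    A ≅ ((functorG s hG).rightOp ⋙ functorF hF).obj A where
  hom := (s A).etaHom
  inv := (AlgEquiv.ofBijective (s A).etaHom (s A).bijective_etaHom).symm.toAlgHom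
  hom_inv_id := AlgHom.ext fun f =>
    (AlgEquiv.ofBijective (s A).etaHom (s A).bijective_etaHom).symm_apply_apply f
  inv_hom_id := AlgHom.ext fun g =>
    (AlgEquiv.ofBijective (s A).etaHom (s A).bijective_etaHom).apply_symm_apply g

/-- The isomorphism `θ_M` in `SmoothMan`. -/
noncomputable def thetaIso (hF : ∀ M : SmoothMan.{u}, IsSmoothAlgebra (CInf M))
    (s : ∀ A : SmoothAlg.{u}, InducedManifold A) (hG : PointsMapsSmooth s) (M : SmoothMan.{u}) :
    M ≅ ((functorF hF).rightOp ⋙ functorG s hG).obj M where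
  -- Smoothness both ways is tested on functions, so `M.dim` and the dimension chosen by `s` need no
  -- comparison.
  hom := ⟨theta M.dim M, (s ⟨CInf M, hF M⟩).contMDiff_of_eval fun f => f.contMDiff⟩
  inv := ⟨(thetaHomeomorph M.dim M).symm, contMDiff_of_forall_contMDiffMap fun f =>
    ((s ⟨CInf M, hF M⟩).contMDiff_eval f).congr fun P =>
      (eval_eq_apply_thetaHomeomorph_symm P f).symm⟩
  hom_inv_id := ContMDiffMap.ext fun x => (thetaHomeomorph M.dim M).symm_apply_apply x
  inv_hom_id := ContMDiffMap.ext fun P => (thetaHomeomorph M.dim M).apply_symm_apply P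

end SmoothDuality

theorem mainTheorem2 :
    ∃ hF : ∀ M : SmoothDuality.SmoothMan.{u},
        SmoothDuality.IsSmoothAlgebra (SmoothDuality.CInf M),
      (∀ A : SmoothDuality.SmoothAlg.{u}, Nonempty (SmoothDuality.InducedManifold A)) ∧
      ∀ s : (∀ A : SmoothDuality.SmoothAlg.{u}, SmoothDuality.InducedManifold A),
        ∃ hG : SmoothDuality.PointsMapsSmooth s,
        ∃ (η : 𝟭 SmoothDuality.SmoothAlg.{u} ≅
              (SmoothDuality.functorG s hG).rightOp ⋙ SmoothDuality.functorF hF)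
          (θ : 𝟭 SmoothDuality.SmoothMan.{u} ≅
              (SmoothDuality.functorF hF).rightOp ⋙ SmoothDuality.functorG s hG),
          SmoothDuality.IsEvalEta η.hom ∧ SmoothDuality.IsEvalTheta θ.hom := by
  refine ⟨fun _ => SmoothDuality.isSmoothAlgebra_contMDiffMap,
    fun A => ⟨A.smooth.cover.choose_spec.inducedManifold⟩, fun s =>
    ⟨SmoothDuality.pointsMapsSmooth s,
      -- Both functors act by precomposition, so naturality of the evaluations is definitional.
      NatIso.ofComponents (SmoothDuality.etaIso _ s _) fun _ => rfl,
      NatIso.ofComponents (SmoothDuality.thetaIso _ s _) fun _ => rfl,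
      fun _ _ _ => rfl, fun _ _ _ => rfl⟩⟩
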